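/- The power graph $\mathcal{P}(G)$ of a group $G$ is the simple graph with vertex set $G$ in which two distinct elements are adjacent if and only if one of them is an integral power of the other. A cut-set of a graph $\Gamma$ with vertex set $V$ is a set $X\subseteq V$ such that the subgraph induced on $V\setminus X$ is disconnected; a minimum cut-set is a cut-set of smallest cardinality. The vertex connectivity $\kappa(\Gamma)$ is the minimum number of vertices whose removal leaves a graph that is disconnected or has only one vertex. A maximal cyclic subgroup of $G$ is a cyclic subgroup not properly contained in any cyclic subgroup of $G$. For a cyclic group $H$, $\widetilde{H}$ denotes the set of all elements of $H$ that do not generate $H$. **Theorem.** Let $p_1<p_2$ be prime numbers, let $n_1,n_2$ be positive integers, let $G$ be a finite non-cyclic abelian group of order $p_1^{n_1}p_2^{n_2}$, and let $P_i$ be the Sylow $p_i$-subgroup of $G$ for $i=1,2$. Then the following hold. (i) Suppose that exactly one of $P_1,P_2$ is non-cyclic, say $P_i$, and let $\{i,j\}=\{1,2\}$. Then $P_j$ is a minimum cut-set of $\mathcal{P}(G)$ and $\kappa(\mathcal{P}(G))=|P_j|=p_j^{n_j}$. If moreover $p_1\geq 3$, or $p_1=2$ and $P_2$ is the non-cyclic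 one, then $P_j$ is the only minimum cut-set of $\mathcal{P}(G)$. (ii) Suppose that both $P_1$ and $P_2$ are non-cyclic. If $p_1\geq 3$ and $C$ is a maximal cyclic subgroup of $G$ of order $p_1p_2$, then $\kappa(\mathcal{P}(G))=\min\{|P_1|,|P_2|,|\widetilde{C}|\}$. (iii) Suppose that both $P_1$ and $P_2$ are non-cyclic and that $P_1$ is elementary abelian. If $C$ is a maximal cyclic subgroup of $G$ of minimum possible order, then $\kappa(\mathcal{P}(G))=\min\{|P_1|,|P_2|,|\widetilde{C}|\}$. -/

import Mathlib

/-- The power graph of a group: two distinct elements are adjacent if and only if one of them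
is an integral power of the other. -/
def powerGraph (G : Type*) [Group G] : SimpleGraph G where
  Adj x y := x ≠ y ∧ (x ∈ Subgroup.zpowers y ∨ y ∈ Subgroup.zpowers x)
  symm := ⟨fun _ _ h => ⟨h.1.symm, h.2.symm⟩⟩
  loopless := ⟨fun _ h => h.1 rfl⟩

/-- `X` is a cut-set of `Γ`: the subgraph induced on the complement of `X` is disconnected
(it has two vertices that are not joined by a path). -/
def IsCutSet {V : Type*} (Γ : SimpleGraph V) (X : Set V) : Prop :=
  ¬ (Γ.induce Xᶜ).Preconnected

/-- `X` is a cut-set of `Γ` whose cardinality is minimum among all cut-sets of `Γ`. -/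
def IsMinimumCutSet {V : Type*} (Γ : SimpleGraph V) (X : Set V) : Prop :=
  IsCutSet Γ X ∧ ∀ Y : Set V, IsCutSet Γ Y → X.encard ≤ Y.encard

/-- The vertex connectivity of `Γ`: the minimum number of vertices whose removal leaves a graph
that is disconnected or has only one vertex. -/
noncomputable def vertexConnectivity {V : Type*} (Γ : SimpleGraph V) : ℕ∞ :=
  ⨅ (X : Set V) (_ : IsCutSet Γ X ∨ Xᶜ.encard = 1), X.encard

/-- A maximal cyclic subgroup: a cyclic subgroup that is not properly contained in any cyclic
subgroup. -/
def IsMaximalCyclic {G : Type*} [Group G] (M : Subgroup G) : Prop :=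
  Maximal (fun H : Subgroup G => IsCyclic H) M

/-- The set of elements of the subgroup `H` that do not generate `H`. -/
def nonGenerators {G : Type*} [Group G] (H : Subgroup G) : Set G :=
  {x | x ∈ H ∧ Subgroup.zpowers x ≠ H}

/-! A cut-set `X` is the same thing as a 2-colouring of the group, constant along edges outside `X`
and using both colours there (`IsSeparation`). Write `G = P × Q` with `P`, `Q` the Sylow subgroups.
By coprimality cyclic subgroups are products, so the maximal ones form a grid indexed by pairs `(x,
y)` of maximal generators (`isMaxGen_prod_iff`). If some generator of `⟨x⟩ × ⟨y⟩` survives outside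
`X`, that cell has a colour shared by all surviving elements of the subgroup. Two cells of different
colours then have their whole intersection inside `X` (`IsSeparation.mem_of_classColor`).

Suppose every cell survives. If the colour depends only on `y`, two columns of opposite colours
force `P × 1 ⊆ X`; symmetrically, if it depends only on `x`, then `1 × Q ⊆ X`. Otherwise some column
`y` is mixed, so `1 × ⟨y⟩ ⊆ X`, and further elements are found in a mixed row, a second mixed
column, or the intersection of two cells in one row. These bring the count to the number of
non-generators of `C`. If a cell does not survive, its `φ(|x|) φ(|y|)` generators lie in `X`; this
suffices for `p ≥ 3`, while `p = 2` needs a second removed cell or a repetition of the colouring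
argument.

The bounds are attained: each Sylow subgroup whose complement is non-cyclic separates, and removing
the non-generators of a maximal cyclic subgroup isolates its generators. -/

open Subgroup

/-- `c` colours the vertices of the power graph in such a way that, outside `X`, both colours
occur and adjacent vertices have the same colour. -/
structure IsSeparation {G : Type*} [Group G] (X : Set G) (c : G → Prop) : Prop where
  exists_pos : ∃ a ∉ X, c a
  exists_neg : ∃ b ∉ X, ¬ c b
  color_iff : ∀ g h, g ∉ X → h ∉ X → g ∈ zpowers h → (c g ↔ c h)

/-- `x` generates a maximal cyclic subgroup. -/
def IsMaxGen {G : Type*} [Group G] (x : G) : Prop :=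
  ∀ y, x ∈ zpowers y → y ∈ zpowers x

/-! ### Cut-sets as colourings -/

section Separation

variable {G : Type*} [Group G] {X : Set G} {c : G → Prop}

theorem IsSeparation.isCutSet (h : IsSeparation X c) : IsCutSet (powerGraph G) X := by
  intro hpre
  obtain ⟨a, ha, hca⟩ := h.exists_pos
  obtain ⟨b, hb, hcb⟩ := h.exists_neg
  obtain ⟨w⟩ := hpre ⟨a, ha⟩ ⟨b, hb⟩
  have key : ∀ u v : (Xᶜ : Set G), ((powerGraph G).induce Xᶜ).Walk u v → (c u ↔ c v) := by
    intro u v w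
    induction w with
    | nil => rfl
    | @cons u v _ hadj _ ih =>
      refine Iff.trans ?_ ih
      have hadj' : (powerGraph G).Adj u v := hadj
      rcases hadj'.2 with h1 | h1
      · exact h.color_iff _ _ u.2 v.2 h1
      · exact (h.color_iff _ _ v.2 u.2 h1).symm
  exact hcb ((key _ _ w).1 hca)

theorem IsCutSet.exists_isSeparation (h : IsCutSet (powerGraph G) X) :
    ∃ c, IsSeparation X c := by
  unfold IsCutSet SimpleGraph.Preconnected at h
  push Not at h
  obtain ⟨a, b, hab⟩ := h
  -- The colour records membership in the connected component of `a`.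
  refine ⟨fun g => ∃ hg : g ∉ X, ((powerGraph G).induce Xᶜ).Reachable a ⟨g, hg⟩,
    ⟨a, a.2, a.2, SimpleGraph.Reachable.refl _⟩, ⟨b, b.2, fun ⟨_, hb⟩ => hab hb⟩, ?_⟩
  intro g k hg hk hgk
  by_cases hne : g = k
  · subst hne; rfl
  have hadj : ((powerGraph G).induce Xᶜ).Adj ⟨g, hg⟩ ⟨k, hk⟩ := by
    change (powerGraph G).Adj g k
    exact ⟨hne, Or.inl hgk⟩
  exact ⟨fun ⟨_, h1⟩ => ⟨hk, h1.trans hadj.reachable⟩,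
    fun ⟨_, h1⟩ => ⟨hg, h1.trans hadj.symm.reachable⟩⟩

theorem IsSeparation.one_mem_cutSet (h : IsSeparation X c) : (1 : G) ∈ X := by
  by_contra h1
  obtain ⟨a, ha, hca⟩ := h.exists_pos
  obtain ⟨b, hb, hcb⟩ := h.exists_neg
  exact hcb ((h.color_iff _ _ h1 hb (zpowers b).one_mem).1 ((h.color_iff _ _ h1 ha (zpowers a).one_mem).2 hca))

theorem IsSeparation.comap {H : Type*} [Group H] (h : IsSeparation X c) (f : H ≃* G) :
    IsSeparation (f ⁻¹' X) (c ∘ f) where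
  exists_pos := by
    obtain ⟨a, ha, hca⟩ := h.exists_pos
    exact ⟨f.symm a, by simpa using ha, by simpa using hca⟩
  exists_neg := by
    obtain ⟨a, ha, hca⟩ := h.exists_neg
    exact ⟨f.symm a, by simpa using ha, by simpa using hca⟩
  color_iff g k hg hk hgk := by
    refine h.color_iff _ _ hg hk ?_
    obtain ⟨n, rfl⟩ := mem_zpowers_iff.1 hgk
    exact mem_zpowers_iff.2 ⟨n, by simp⟩

/-- The colour of the class of generators of `zpowers m`, if not all of them are in `X`. -/
def classColor (X : Set G) (c : G → Prop) (m : G) : Prop :=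
  ∃ g ∉ X, zpowers g = zpowers m ∧ c g

/-- All survivors of `⟨m⟩` are adjacent or equal to a surviving generator. Without one, `classColor`
is false by default, hence the hypothesis `hm`. -/
theorem IsSeparation.color_iff_classColor (h : IsSeparation X c) {m k : G}
    (hm : ∃ g ∉ X, zpowers g = zpowers m) (hk : k ∉ X) (hkm : k ∈ zpowers m) :
    c k ↔ classColor X c m := by
  constructor
  · intro hc
    obtain ⟨g, hg, hgm⟩ := hm
    exact ⟨g, hg, hgm, (h.color_iff k g hk hg (hgm ▸ hkm)).1 hc⟩
  · rintro ⟨g, hg, hgm, hc⟩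
    exact (h.color_iff k g hk hg (hgm ▸ hkm)).2 hc

/-- A survivor common to both subgroups would carry both colours. This puts whole intersections into
`X` in the counting arguments. -/
theorem IsSeparation.mem_of_classColor (h : IsSeparation X c) {m m' k : G}
    (hm : ∃ g ∉ X, zpowers g = zpowers m) (hm' : ∃ g ∉ X, zpowers g = zpowers m')
    (hc : classColor X c m) (hc' : ¬ classColor X c m')
    (hk : k ∈ zpowers m) (hk' : k ∈ zpowers m') : k ∈ X := by
  by_contra hkX
  exact hc' ((h.color_iff_classColor hm' hkX hk').1 ((h.color_iff_classColor hm hkX hk).2 hc))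

end Separation

/-! ### Generators of maximal cyclic subgroups -/

section MaxGen

variable {G : Type*} [Group G]

theorem IsMaxGen.zpowers_eq {x y : G} (hx : IsMaxGen x) (h : x ∈ zpowers y) :
    zpowers x = zpowers y :=
  le_antisymm (zpowers_le.2 h) (zpowers_le.2 (hx y h))

theorem IsMaxGen.of_zpowers_eq {x y : G} (hx : IsMaxGen x) (h : zpowers x = zpowers y) :
    IsMaxGen y := by
  intro z hz
  have : x ∈ zpowers z := zpowers_le.2 hz (h ▸ mem_zpowers x)
  exact h ▸ hx z this

theorem exists_isMaxGen [Finite G] (x : G) : ∃ m, IsMaxGen m ∧ x ∈ zpowers m := by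
  obtain ⟨m, hm, hmax⟩ := Set.exists_max_image {y : G | x ∈ zpowers y} orderOf
    (Set.toFinite _) ⟨x, mem_zpowers x⟩
  refine ⟨m, fun y hy => ?_, hm⟩
  have hle : zpowers m ≤ zpowers y := zpowers_le.2 hy
  have h1 : orderOf y ≤ orderOf m := hmax y (hle hm)
  have : zpowers m = zpowers y := by
    apply Subgroup.eq_of_le_of_card_ge hle
    simpa [Nat.card_zpowers] using h1
  rw [this]
  exact mem_zpowers y

theorem IsMaxGen.ne_one [Nontrivial G] {x : G} (hx : IsMaxGen x) : x ≠ 1 := by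
  rintro rfl
  obtain ⟨y, hy⟩ := exists_ne (1 : G)
  exact hy (by simpa using hx y (one_mem _))

theorem isMaximalCyclic_iff {C : Subgroup G} :
    IsMaximalCyclic C ↔ ∃ m, IsMaxGen m ∧ C = zpowers m := by
  constructor
  · rintro ⟨hC, hmax⟩
    obtain ⟨m, rfl⟩ := (Subgroup.isCyclic_iff_exists_zpowers_eq_top C).1 hC
    refine ⟨m, fun y hy => ?_, rfl⟩
    exact hmax (y := zpowers y) (inferInstanceAs (IsCyclic (zpowers y))) (zpowers_le.2 hy)
      (mem_zpowers y)
  · rintro ⟨m, hm, rfl⟩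
    refine ⟨inferInstanceAs (IsCyclic (zpowers m)), fun H hH hle => ?_⟩
    obtain ⟨y, rfl⟩ := (Subgroup.isCyclic_iff_exists_zpowers_eq_top H).1 hH
    exact zpowers_le.2 (hm y (zpowers_le.1 hle))

theorem ncard_generators [Finite G] (m : G) :
    {g : G | zpowers g = zpowers m}.ncard = (orderOf m).totient := by
  classical
  have h : {g : G | zpowers g = zpowers m} =
      ((Finset.range (orderOf m)).filter fun k => (orderOf m).Coprime k).image (m ^ ·) := by
    ext g
    simp only [Set.mem_ofPred_eq, Finset.coe_image, Finset.coe_filter, Finset.mem_range,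
      Set.mem_image]
    constructor
    · intro hg
      have h1 : g ∈ zpowers m := hg ▸ mem_zpowers g
      rw [mem_zpowers_iff_mem_range_orderOf, Finset.mem_image] at h1
      obtain ⟨k, hk, rfl⟩ := h1
      refine ⟨k, ⟨Finset.mem_range.1 hk, ?_⟩, rfl⟩
      have h2 : m ∈ zpowers (m ^ k) := hg ▸ mem_zpowers m
      have := mem_zpowers_pow_iff.1 h2
      rw [Nat.coprime_comm]
      exact this
    · rintro ⟨k, ⟨_, hk⟩, rfl⟩
      refine le_antisymm (zpowers_le.2 (npow_mem_zpowers m k)) (zpowers_le.2 ?_)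
      refine mem_zpowers_pow_iff.2 ?_
      have := hk.symm
      exact this
  rw [h, Set.ncard_coe_finset, Finset.card_image_of_injOn, Nat.totient]
  intro a ha b hb hab
  simp only [Finset.coe_filter, Finset.mem_range, Set.mem_ofPred_eq] at ha hb
  exact pow_injOn_Iio_orderOf ha.1 hb.1 hab

theorem ncard_zpowers (m : G) : (zpowers m : Set G).ncard = orderOf m := by
  rw [← Nat.card_coe_set_eq]
  exact Nat.card_zpowers m

end MaxGen

/-! ### Cyclic subgroups of p-groups -/

section PGroup

variable {G : Type*} [Group G] {p : ℕ}

theorem IsPGroup.mem_zpowers_pow_of_not_dvd (hp : p.Prime) (hG : IsPGroup p G) (g : G) {k : ℕ}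
    (hk : ¬ p ∣ k) : g ∈ zpowers (g ^ k) :=
  mem_zpowers_pow_iff.2 (hG.orderOf_coprime ((hp.coprime_iff_not_dvd).2 hk) g).symm

/-- A power `h ^ k` generates `⟨h⟩` unless `p ∣ k`, so all proper subgroups of `⟨h⟩` lie in `⟨h ^
p⟩`. -/
theorem IsPGroup.mem_zpowers_pow_of_zpowers_ne [Finite G] (hp : p.Prime) (hG : IsPGroup p G)
    {g h : G} (hgh : g ∈ zpowers h) (hne : zpowers g ≠ zpowers h) : g ∈ zpowers (h ^ p) := by
  obtain ⟨k, rfl⟩ := mem_powers_iff_mem_zpowers.2 hgh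
  by_cases hk : p ∣ k
  · obtain ⟨l, rfl⟩ := hk
    simp only [pow_mul]
    exact npow_mem_zpowers _ _
  · exact absurd (le_antisymm (zpowers_le.2 hgh)
      (zpowers_le.2 (hG.mem_zpowers_pow_of_not_dvd hp h hk))) hne

/-- Subgroups of a cyclic p-group form a chain: if both are proper, descend from `⟨w⟩` to `⟨w ^ p⟩`.
-/
theorem IsPGroup.mem_zpowers_total [Finite G] (hp : p.Prime) (hG : IsPGroup p G) {u v w : G}
    (hu : u ∈ zpowers w) (hv : v ∈ zpowers w) : u ∈ zpowers v ∨ v ∈ zpowers u := by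
  obtain ⟨n, hn⟩ := hG w
  induction n generalizing w with
  | zero =>
    obtain rfl : w = 1 := by simpa using hn
    simp only [zpowers_one_eq_bot, mem_bot] at hu
    exact Or.inl (hu ▸ one_mem _)
  | succ n ih =>
    by_cases h1 : zpowers u = zpowers w
    · exact Or.inr (h1 ▸ hv)
    by_cases h2 : zpowers v = zpowers w
    · exact Or.inl (h2 ▸ hu)
    refine ih (hG.mem_zpowers_pow_of_zpowers_ne hp hu h1)
      (hG.mem_zpowers_pow_of_zpowers_ne hp hv h2) ?_
    rw [← pow_mul, ← pow_succ']
    exact hn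

theorem IsPGroup.exists_orderOf_eq_mul [Finite G] (hp : p.Prime) (hG : IsPGroup p G) {g : G}
    (hg : g ≠ 1) : ∃ e, 0 < e ∧ orderOf g = p * e ∧ (orderOf g).totient = (p - 1) * e ∧
      orderOf (g ^ p) = e := by
  have := Fact.mk hp
  obtain ⟨k, hk⟩ := IsPGroup.iff_orderOf.1 hG g
  rcases k with _ | k
  · simp at hk; exact absurd hk hg
  · refine ⟨p ^ k, pow_pos hp.pos k, by rw [hk, pow_succ'], ?_, ?_⟩
    · rw [hk, Nat.totient_prime_pow_succ hp, mul_comm]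
    · rw [orderOf_pow' _ hp.ne_zero, hk, pow_succ, Nat.gcd_mul_left_left, Nat.mul_div_cancel _ hp.pos]

theorem zpowers_eq_of_mem_of_pow_prime_eq_one (hp : p.Prime) {u v : G} (hv : v ^ p = 1)
    (hu : u ≠ 1) (huv : u ∈ zpowers v) : zpowers u = zpowers v := by
  have := Fact.mk hp
  have hv1 : v ≠ 1 := by
    rintro rfl
    exact hu (by simpa using huv)
  have hov : orderOf v = p := orderOf_eq_prime hv hv1
  have hou : orderOf u = p :=
    ((Nat.dvd_prime hp).1 (hov ▸ orderOf_dvd_of_mem_zpowers huv)).resolve_left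
      (by rwa [orderOf_eq_one_iff])
  have : Finite (zpowers v) := by
    apply Nat.finite_of_card_ne_zero
    rw [Nat.card_zpowers, hov]; exact hp.ne_zero
  apply Subgroup.eq_of_le_of_card_ge (zpowers_le.2 huv)
  rw [Nat.card_zpowers, Nat.card_zpowers, hou, hov]

end PGroup

section CommPGroup

variable {G : Type*} [CommGroup G] [Finite G] {p : ℕ}

/-- If `⟨y⟩` contained all the p-torsion, it would be everything. By induction `w ^ p = y ^ k`; when
`p ∣ k`, `w` differs from a power of `y` by p-torsion, and otherwise `y ∈ ⟨w⟩`, so maximality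
applies. -/
theorem IsMaxGen.exists_pow_eq_one_notMem (hp : p.Prime) (hG : IsPGroup p G) (hcyc : ¬ IsCyclic G)
    {y : G} (hy : IsMaxGen y) : ∃ z : G, z ^ p = 1 ∧ z ∉ zpowers y := by
  by_contra! hz
  refine hcyc ⟨y, fun w => ?_⟩
  change w ∈ zpowers y
  obtain ⟨n, hn⟩ := hG w
  induction n generalizing w with
  | zero =>
    obtain rfl : w = 1 := by simpa using hn
    exact one_mem _
  | succ n ih =>
    have hw : w ^ p ∈ zpowers y := ih _ (by rw [← pow_mul, ← pow_succ']; exact hn)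
    obtain ⟨k, hk⟩ := mem_powers_iff_mem_zpowers.2 hw
    simp only at hk
    by_cases hpk : p ∣ k
    · obtain ⟨l, rfl⟩ := hpk
      have h1 : (w * (y ^ l)⁻¹) ^ p = 1 := by
        rw [mul_pow, inv_pow, ← pow_mul, mul_comm l, hk, mul_inv_cancel]
      have := mul_mem (hz _ h1) (npow_mem_zpowers y l)
      simpa using this
    · have h1 := hG.mem_zpowers_pow_of_not_dvd hp y hpk
      rw [hk] at h1
      exact hy w (zpowers_le.2 (npow_mem_zpowers w p) h1)

/-- Take `z` of p-torsion outside `⟨y⟩` and a maximal cyclic subgroup containing `y * z`: it is not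
`⟨y⟩`, yet it contains `(y * z) ^ p = y ^ p`. -/
theorem IsMaxGen.exists_isMaxGen_ne (hp : p.Prime) (hG : IsPGroup p G) (hcyc : ¬ IsCyclic G)
    {y : G} (hy : IsMaxGen y) :
    ∃ y', IsMaxGen y' ∧ zpowers y' ≠ zpowers y ∧ y ^ p ∈ zpowers y' := by
  obtain ⟨z, hz, hzy⟩ := hy.exists_pow_eq_one_notMem hp hG hcyc
  obtain ⟨y', hy', hmem⟩ := exists_isMaxGen (y * z)
  refine ⟨y', hy', fun h => hzy ?_, ?_⟩
  · rw [h] at hmem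
    simpa using mul_mem (inv_mem (mem_zpowers y)) hmem
  · have := pow_mem hmem p
    rwa [mul_pow, hz, mul_one] at this

end CommPGroup

/-! ### Products of coprime order -/

theorem orderOf_prod_of_coprime {P Q : Type*} [Group P] [Group Q]
    (h : (Nat.card P).Coprime (Nat.card Q)) (m : P × Q) :
    orderOf m = orderOf m.1 * orderOf m.2 := by
  rw [Prod.orderOf,
    (Nat.Coprime.of_dvd (orderOf_dvd_natCard m.1) (orderOf_dvd_natCard m.2) h).lcm_eq_mul]

section Prod

variable {P Q : Type*} [Group P] [Group Q] [Finite P] [Finite Q]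

theorem zpowers_prod_of_coprime (h : (Nat.card P).Coprime (Nat.card Q)) (m : P × Q) :
    zpowers m = (zpowers m.1).prod (zpowers m.2) := by
  have hle : zpowers m ≤ (zpowers m.1).prod (zpowers m.2) :=
    zpowers_le.2 ⟨mem_zpowers _, mem_zpowers _⟩
  apply Subgroup.eq_of_le_of_card_ge hle
  rw [Nat.card_congr (Subgroup.prodEquiv _ _).toEquiv, Nat.card_prod, Nat.card_zpowers,
    Nat.card_zpowers, Nat.card_zpowers, Prod.orderOf,
    (Nat.Coprime.of_dvd (orderOf_dvd_natCard m.1) (orderOf_dvd_natCard m.2) h).lcm_eq_mul]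

theorem mem_zpowers_prod_iff (h : (Nat.card P).Coprime (Nat.card Q)) {g m : P × Q} :
    g ∈ zpowers m ↔ g.1 ∈ zpowers m.1 ∧ g.2 ∈ zpowers m.2 := by
  rw [zpowers_prod_of_coprime h, Subgroup.mem_prod]

theorem zpowers_prod_eq_iff (h : (Nat.card P).Coprime (Nat.card Q)) {g m : P × Q} :
    zpowers g = zpowers m ↔ zpowers g.1 = zpowers m.1 ∧ zpowers g.2 = zpowers m.2 := by
  simp only [le_antisymm_iff, zpowers_le, mem_zpowers_prod_iff h]
  tauto

theorem isMaxGen_prod_iff (h : (Nat.card P).Coprime (Nat.card Q)) {m : P × Q} :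
    IsMaxGen m ↔ IsMaxGen m.1 ∧ IsMaxGen m.2 := by
  constructor
  · intro hm
    constructor
    · intro y hy
      exact ((mem_zpowers_prod_iff h).1 (hm (y, m.2)
        ((mem_zpowers_prod_iff h).2 ⟨hy, mem_zpowers _⟩))).1
    · intro y hy
      exact ((mem_zpowers_prod_iff h).1 (hm (m.1, y)
        ((mem_zpowers_prod_iff h).2 ⟨mem_zpowers _, hy⟩))).2
  · rintro ⟨h1, h2⟩ y hy
    rw [mem_zpowers_prod_iff h] at hy ⊢
    exact ⟨h1 _ hy.1, h2 _ hy.2⟩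

theorem ncard_generators_prod (h : (Nat.card P).Coprime (Nat.card Q)) (m : P × Q) :
    {g : P × Q | zpowers g = zpowers m}.ncard =
      (orderOf m.1).totient * (orderOf m.2).totient := by
  rw [ncard_generators, orderOf_prod_of_coprime h, Nat.totient_mul
    (Nat.Coprime.of_dvd (orderOf_dvd_natCard m.1) (orderOf_dvd_natCard m.2) h)]

end Prod

/-- Some generator of `zpowers m` lies outside `X`. -/
def Survives {G : Type*} [Group G] (X : Set G) (m : G) : Prop :=
  ∃ g ∉ X, zpowers g = zpowers m

theorem mem_of_not_survives {G : Type*} [Group G] {X : Set G} {m g : G} (h : ¬ Survives X m)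
    (hg : zpowers g = zpowers m) : g ∈ X := by
  by_contra hgX
  exact h ⟨g, hgX, hg⟩

/-! ### Numerical inequalities -/

section Arithmetic

/-- The difference of the coefficients is `(p - 2)(q - 2) - 2`, nonnegative since `p ≥ 3` and `q ≥
4`. -/
theorem add_sub_one_mul_le_sub_one_mul_sub_one {p q e E : ℕ} (hp : 3 ≤ p) (hpq : p < q)
    (he : E ≤ e) : (p + q - 1) * E ≤ (p - 1) * ((q - 1) * e) := by
  obtain ⟨a, rfl⟩ := Nat.exists_eq_add_of_le hp
  obtain ⟨b, rfl⟩ := Nat.exists_eq_add_of_lt hpq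
  rw [← mul_assoc]
  refine Nat.mul_le_mul ?_ he
  have h1 : 3 + a + (3 + a + b + 1) - 1 = 2 * a + b + 6 := by omega
  have h2 : 3 + a - 1 = a + 2 := by omega
  have h3 : 3 + a + b + 1 - 1 = a + b + 3 := by omega
  rw [h1, h2, h3]
  nlinarith [Nat.zero_le (a * b), Nat.zero_le (a * a)]

theorem two_add_sub_one_mul_le {q e e' E : ℕ} (hq : 2 < q) (he : E ≤ e) (he' : E ≤ e') :
    (2 + q - 1) * E ≤ (q - 1) * e + (q - 1) * e' := by
  obtain ⟨b, rfl⟩ := Nat.exists_eq_add_of_lt hq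
  have h1 : 2 + (2 + b + 1) - 1 = b + 4 := by omega
  have h2 : 2 + b + 1 - 1 = b + 2 := by omega
  rw [h1, h2]
  nlinarith [Nat.mul_le_mul_left (b + 2) he, Nat.mul_le_mul_left (b + 2) he', Nat.zero_le (b * E)]

theorem add_sub_one_mul_le_mul_add_sub_one_mul {p q e e' E : ℕ} (hp : 0 < p) (hpq : p < q)
    (he : E ≤ e) (he' : E ≤ e') : (p + q - 1) * E ≤ q * e + (q - 1) * e' := by
  have h1 : (p + q - 1) * E ≤ (q + (q - 1)) * E := Nat.mul_le_mul_right _ (by omega)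
  have h2 := Nat.mul_le_mul_left q he
  have h3 := Nat.mul_le_mul_left (q - 1) he'
  rw [add_mul] at h1
  omega

end Arithmetic

/-! ### Counting by projections and disjoint pieces -/

section Counting

variable {P Q : Type*} [Finite P] [Finite Q] {X : Set (P × Q)}

theorem card_le_ncard_of_forall_exists_left (h : ∀ u : P, ∃ v : Q, (u, v) ∈ X) :
    Nat.card P ≤ X.ncard := by
  have h1 : Prod.fst '' X = Set.univ := by
    ext u
    simpa using h u
  rw [← Set.ncard_univ, ← h1]
  exact Set.ncard_image_le (Set.toFinite _)

theorem card_le_ncard_of_forall_exists_right (h : ∀ v : Q, ∃ u : P, (u, v) ∈ X) :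
    Nat.card Q ≤ X.ncard := by
  have h1 : Prod.snd '' X = Set.univ := by
    ext u
    simpa using h u
  rw [← Set.ncard_univ, ← h1]
  exact Set.ncard_image_le (Set.toFinite _)

theorem add_ncard_le {A B : Set (P × Q)} (hA : A ⊆ X) (hB : B ⊆ X) (h : Disjoint A B) :
    A.ncard + B.ncard ≤ X.ncard := by
  rw [← Set.ncard_union_eq h]
  exact Set.ncard_le_ncard (Set.union_subset hA hB)

end Counting

/-! ### Lower bounds: odd primes, and one cyclic factor -/

section Bounds

variable {P Q : Type*} [CommGroup P] [CommGroup Q] [Finite P] [Finite Q]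
  {X : Set (P × Q)} {c : P × Q → Prop}

theorem totient_mul_totient_le_ncard (hco : (Nat.card P).Coprime (Nat.card Q)) {m : P × Q}
    (h : ¬ Survives X m) : (orderOf m.1).totient * (orderOf m.2).totient ≤ X.ncard := by
  rw [← ncard_generators_prod hco]
  exact Set.ncard_le_ncard fun g hg => mem_of_not_survives h hg

theorem IsSeparation.mem_of_classColor_prod (hco : (Nat.card P).Coprime (Nat.card Q))
    (hX : IsSeparation X c) {x x' : P} {y y' : Q} (hm : Survives X (x, y))
    (hm' : Survives X (x', y')) (hc : classColor X c (x, y)) (hc' : ¬ classColor X c (x', y'))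
    {u : P} {v : Q} (hu : u ∈ zpowers x) (hu' : u ∈ zpowers x') (hv : v ∈ zpowers y)
    (hv' : v ∈ zpowers y') : (u, v) ∈ X :=
  hX.mem_of_classColor hm hm' hc hc' ((mem_zpowers_prod_iff hco).2 ⟨hu, hv⟩)
    ((mem_zpowers_prod_iff hco).2 ⟨hu', hv'⟩)

theorem exists_isMaxGen_prod (hco : (Nat.card P).Coprime (Nat.card Q)) (a : P × Q) :
    ∃ x y, IsMaxGen x ∧ IsMaxGen y ∧ a ∈ zpowers (x, y) := by
  obtain ⟨x, hx, hax⟩ := exists_isMaxGen a.1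
  obtain ⟨y, hy, hay⟩ := exists_isMaxGen a.2
  exact ⟨x, y, hx, hy, (mem_zpowers_prod_iff hco).2 ⟨hax, hay⟩⟩

theorem IsSeparation.exists_classColor (hco : (Nat.card P).Coprime (Nat.card Q))
    (hX : IsSeparation X c) (hs : ∀ x y, IsMaxGen x → IsMaxGen y → Survives X (x, y)) :
    ∃ x y, IsMaxGen x ∧ IsMaxGen y ∧ classColor X c (x, y) := by
  obtain ⟨a, ha, hca⟩ := hX.exists_pos
  obtain ⟨x, y, hx, hy, hxy⟩ := exists_isMaxGen_prod hco a
  exact ⟨x, y, hx, hy, (hX.color_iff_classColor (hs x y hx hy) ha hxy).1 hca⟩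

theorem IsSeparation.exists_not_classColor (hco : (Nat.card P).Coprime (Nat.card Q))
    (hX : IsSeparation X c) (hs : ∀ x y, IsMaxGen x → IsMaxGen y → Survives X (x, y)) :
    ∃ x y, IsMaxGen x ∧ IsMaxGen y ∧ ¬ classColor X c (x, y) := by
  obtain ⟨a, ha, hca⟩ := hX.exists_neg
  obtain ⟨x, y, hx, hy, hxy⟩ := exists_isMaxGen_prod hco a
  exact ⟨x, y, hx, hy, fun h => hca ((hX.color_iff_classColor (hs x y hx hy) ha hxy).2 h)⟩

/-- The lower bound for a product of nontrivial groups of coprime odd prime power orders. -/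
theorem IsSeparation.lower_bound_of_three_le {p q : ℕ} (hp : p.Prime) (hq : q.Prime)
    (hP : IsPGroup p P) (hQ : IsPGroup q Q) [Nontrivial P] [Nontrivial Q] (hp3 : 3 ≤ p)
    (hpq : p < q) (hco : (Nat.card P).Coprime (Nat.card Q)) (hX : IsSeparation X c) :
    Nat.card P ≤ X.ncard ∨ Nat.card Q ≤ X.ncard ∨ p + q - 1 ≤ X.ncard := by
  by_cases hs : ∀ x y, IsMaxGen x → IsMaxGen y → Survives X (x, y)
  · obtain ⟨x₀, y₀, hx₀, hy₀, h₀⟩ := hX.exists_classColor hco hs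
    obtain ⟨x₁, y₁, hx₁, hy₁, h₁⟩ := hX.exists_not_classColor hco hs
    by_cases hcol : ∀ y x x', IsMaxGen y → IsMaxGen x → IsMaxGen x' →
        classColor X c (x, y) → classColor X c (x', y)
    · left
      refine card_le_ncard_of_forall_exists_left fun u => ⟨1, ?_⟩
      obtain ⟨x, hx, hu⟩ := exists_isMaxGen u
      exact hX.mem_of_classColor_prod hco (hs x y₀ hx hy₀) (hs x y₁ hx hy₁)
        (hcol _ _ _ hy₀ hx₀ hx h₀) (fun h => h₁ (hcol _ _ _ hy₁ hx hx₁ h)) hu hu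
        (one_mem _) (one_mem _)
    by_cases hrow : ∀ x y y', IsMaxGen x → IsMaxGen y → IsMaxGen y' →
        classColor X c (x, y) → classColor X c (x, y')
    · right; left
      refine card_le_ncard_of_forall_exists_right fun v => ⟨1, ?_⟩
      obtain ⟨y, hy, hv⟩ := exists_isMaxGen v
      exact hX.mem_of_classColor_prod hco (hs x₀ y hx₀ hy) (hs x₁ y hx₁ hy)
        (hrow _ _ _ hx₀ hy₀ hy h₀) (fun h => h₁ (hrow _ _ _ hx₁ hy hy₁ h))
        (one_mem _) (one_mem _) hv hv
    push Not at hcol hrow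
    obtain ⟨y, x, x', hy, hx, hx', h1, h2⟩ := hcol
    obtain ⟨x₂, y₂, y₂', hx₂, hy₂, hy₂', h3, h4⟩ := hrow
    -- A mixed column and a mixed row: `1 × ⟨y⟩` and `⟨x₂⟩ × 1` lie in `X` and meet only in the
    -- identity, giving at least `q + (p - 1)` elements.
    right; right
    have hA : ({1} : Set P) ×ˢ (zpowers y : Set Q) ⊆ X := by
      rintro ⟨u, v⟩ ⟨hu, hv⟩
      obtain rfl : u = 1 := hu
      exact hX.mem_of_classColor_prod hco (hs x y hx hy) (hs x' y hx' hy) h1 h2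
        (one_mem _) (one_mem _) hv hv
    have hB : ((zpowers x₂ : Set P) \ {1}) ×ˢ ({1} : Set Q) ⊆ X := by
      rintro ⟨u, v⟩ ⟨hu, hv⟩
      obtain rfl : v = 1 := hv
      exact hX.mem_of_classColor_prod hco (hs x₂ y₂ hx₂ hy₂) (hs x₂ y₂' hx₂ hy₂') h3 h4
        hu.1 hu.1 (one_mem _) (one_mem _)
    have hle := add_ncard_le hA hB (Set.disjoint_left.2 fun g hg hg' => hg'.1.2 hg.1)
    rw [Set.ncard_prod, Set.ncard_prod, Set.ncard_singleton, Set.ncard_singleton, ncard_zpowers,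
      Set.ncard_sdiff_singleton_of_mem (one_mem (zpowers x₂)), ncard_zpowers] at hle
    have : Fact p.Prime := ⟨hp⟩
    have : Fact q.Prime := ⟨hq⟩
    have hpo := Nat.le_of_dvd (orderOf_pos x₂) (hP.dvd_orderOf hx₂.ne_one)
    have hqo := Nat.le_of_dvd (orderOf_pos y) (hQ.dvd_orderOf hy.ne_one)
    omega
  · push Not at hs
    obtain ⟨x, y, hx, hy, h⟩ := hs
    right; right
    have h1 := totient_mul_totient_le_ncard hco h
    obtain ⟨e, he, -, het, -⟩ := hP.exists_orderOf_eq_mul hp hx.ne_one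
    obtain ⟨f, hf, -, hft, -⟩ := hQ.exists_orderOf_eq_mul hq hy.ne_one
    simp only [het, hft] at h1
    have h2 := add_sub_one_mul_le_sub_one_mul_sub_one (e := f) (E := 1) hp3 hpq hf
    have h3 : (p - 1) * ((q - 1) * f) ≤ (p - 1) * e * ((q - 1) * f) :=
      Nat.mul_le_mul_right _ (Nat.le_mul_of_pos_right _ he)
    omega

/-- The bound for a separation with cyclic second factor, refined to equality for odd `p`. -/
theorem IsSeparation.lower_bound_of_isCyclic {p q : ℕ} (hp : p.Prime) (hq : q.Prime)
    (hP : IsPGroup p P) (hQ : IsPGroup q Q) (hPc : ¬ IsCyclic P) [IsCyclic Q] [Nontrivial Q]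
    (hpq : p ≠ q) (hco : (Nat.card P).Coprime (Nat.card Q)) (hX : IsSeparation X c) :
    (∀ v, ((1 : P), v) ∈ X) ∨ Nat.card Q < X.ncard ∨ (p = 2 ∧ Nat.card Q ≤ X.ncard) := by
  have hPn : Nontrivial P := by
    by_contra h
    rw [not_nontrivial_iff_subsingleton] at h
    exact hPc inferInstance
  obtain ⟨y, hy⟩ := IsCyclic.exists_generator (α := Q)
  have hymax : IsMaxGen y := fun z _ => hy z
  have hord : orderOf y = Nat.card Q := orderOf_eq_card_of_forall_mem_zpowers hy
  obtain ⟨f, hf, hfo, hft, -⟩ := hQ.exists_orderOf_eq_mul hq hymax.ne_one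
  have key : ∀ x x', Survives X (x, y) → Survives X (x', y) → classColor X c (x, y) →
      ¬ classColor X c (x', y) → ∀ v, ((1 : P), v) ∈ X := fun x x' hs hs' h h' v =>
    hX.mem_of_classColor_prod hco hs hs' h h' (one_mem _) (one_mem _) (hy v) (hy v)
  have mem_iff : ∀ {x : P} {a : P × Q}, a.1 ∈ zpowers x → a ∈ zpowers (x, y) := fun h =>
    (mem_zpowers_prod_iff hco).2 ⟨h, hy _⟩
  by_cases hs : ∀ x, IsMaxGen x → Survives X (x, y)
  · left
    obtain ⟨a, ha, hca⟩ := hX.exists_pos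
    obtain ⟨b, hb, hcb⟩ := hX.exists_neg
    obtain ⟨x, hx, hax⟩ := exists_isMaxGen a.1
    obtain ⟨x', hx', hbx⟩ := exists_isMaxGen b.1
    exact key x x' (hs x hx) (hs x' hx')
      ((hX.color_iff_classColor (hs x hx) ha (mem_iff hax)).1 hca)
      fun h => hcb ((hX.color_iff_classColor (hs x' hx') hb (mem_iff hbx)).2 h)
  push Not at hs
  obtain ⟨x₁, hx₁, hs₁⟩ := hs
  obtain ⟨e, he, heo, het, -⟩ := hP.exists_orderOf_eq_mul hp hx₁.ne_one
  have hsub : {g : P × Q | zpowers g = zpowers (x₁, y)} ⊆ X := fun g hg =>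
    mem_of_not_survives hs₁ hg
  -- The removed cell has `(p - 1) e (q - 1) f` elements. If the first factor is at least 2, this is
  -- at least `q f = |Q|`, and the identity, in `X` but not in the cell, makes the bound strict.
  by_cases h2 : 2 ≤ (p - 1) * e
  · right; left
    have hlt : {g : P × Q | zpowers g = zpowers (x₁, y)}.ncard < X.ncard := by
      refine Set.ncard_lt_ncard ⟨hsub, fun h => ?_⟩
      have h1 : zpowers (1 : P × Q) = zpowers (x₁, y) := h hX.one_mem_cutSet
      rw [zpowers_one_eq_bot, eq_comm, zpowers_eq_bot] at h1
      exact hx₁.ne_one (congrArg Prod.fst h1)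
    rw [ncard_generators_prod hco] at hlt
    simp only [het, hft] at hlt
    refine lt_of_le_of_lt ?_ hlt
    rw [← hord, hfo]
    have h3 : 2 * ((q - 1) * f) ≤ (p - 1) * e * ((q - 1) * f) := Nat.mul_le_mul_right _ h2
    have h4 : q * f ≤ 2 * (q - 1) * f := Nat.mul_le_mul_right _ (by have := hq.two_le; omega)
    rw [mul_assoc] at h4
    exact h4.trans h3
  -- What remains is `φ(|x₁|) = 1`, so `x₁` is an involution.
  have hp2 : p = 2 := by
    have := hp.two_le
    by_contra hne
    have : 2 * 1 ≤ (p - 1) * e := Nat.mul_le_mul (by omega) he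
    omega
  subst hp2
  obtain rfl : e = 1 := by omega
  have hx₁2 : x₁ ^ 2 = 1 := by
    rw [← orderOf_dvd_iff_pow_eq_one, heo]
  have hq2 : 2 < q := lt_of_le_of_ne hq.two_le hpq
  by_cases hs' : ∀ x, IsMaxGen x → zpowers x ≠ zpowers x₁ → Survives X (x, y)
  swap
  · push Not at hs'
    obtain ⟨x₂, hx₂, hne, hs₂⟩ := hs'
    right; right
    refine ⟨rfl, ?_⟩
    have hle := add_ncard_le hsub (B := {g : P × Q | zpowers g = zpowers (x₂, y)})
      (fun g hg => mem_of_not_survives hs₂ hg) (by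
        refine Set.disjoint_left.2 fun g hg hg' => hne ?_
        exact ((zpowers_prod_eq_iff hco).1 (hg'.symm.trans hg)).1)
    rw [ncard_generators_prod hco, ncard_generators_prod hco] at hle
    simp only [het, hft] at hle
    have h1 : 1 ≤ (orderOf x₂).totient := Nat.totient_pos.2 (orderOf_pos _)
    have h3 : 1 * ((q - 1) * f) ≤ (orderOf x₂).totient * ((q - 1) * f) :=
      Nat.mul_le_mul_right _ h1
    have h4 : q * f ≤ 2 * (q - 1) * f := Nat.mul_le_mul_right _ (by omega)
    rw [mul_assoc] at h4
    omega
  obtain ⟨x₂, hx₂, hne₂, -⟩ := hx₁.exists_isMaxGen_ne hp hP hPc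
  -- every remaining class has the colour of `(x₂, y)`, or we are done
  by_cases hall : ∀ x, IsMaxGen x → zpowers x ≠ zpowers x₁ →
      (classColor X c (x, y) ↔ classColor X c (x₂, y))
  swap
  · push Not at hall
    obtain ⟨x, hx, hne, h⟩ := hall
    left
    rcases h with ⟨h1, h2⟩ | ⟨h1, h2⟩
    · exact key x x₂ (hs' x hx hne) (hs' x₂ hx₂ hne₂) h1 h2
    · exact key x₂ x (hs' x₂ hx₂ hne₂) (hs' x hx hne) h2 h1
  right; right
  refine ⟨rfl, ?_⟩
  obtain ⟨a, ha, hca⟩ : ∃ a ∉ X, ¬ (c a ↔ classColor X c (x₂, y)) := by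
    by_cases h : classColor X c (x₂, y)
    · obtain ⟨b, hb, hcb⟩ := hX.exists_neg
      exact ⟨b, hb, fun h' => hcb (h'.2 h)⟩
    · obtain ⟨b, hb, hcb⟩ := hX.exists_pos
      exact ⟨b, hb, fun h' => h (h'.1 hcb)⟩
  have hcolor : ∀ g ∉ X, ∀ x, IsMaxGen x → zpowers x ≠ zpowers x₁ → g.1 ∈ zpowers x →
      (c g ↔ classColor X c (x₂, y)) := fun g hg x hx hne hgx =>
    (hX.color_iff_classColor (hs' x hx hne) hg (mem_iff hgx)).trans (hall x hx hne)
  have hone : ∀ v, ((1 : P), v) ∉ X → (c (1, v) ↔ classColor X c (x₂, y)) := fun v hv =>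
    hcolor _ hv x₂ hx₂ hne₂ (one_mem _)
  obtain ⟨u, v⟩ := a
  have hu : zpowers u = zpowers x₁ := by
    obtain ⟨x, hx, hux⟩ := exists_isMaxGen u
    have hxx : zpowers x = zpowers x₁ := by
      by_contra hne
      exact hca (hcolor _ ha x hx hne hux)
    refine zpowers_eq_of_mem_of_pow_prime_eq_one hp hx₁2 ?_ (hxx ▸ hux)
    rintro rfl
    exact hca (hone v ha)
  -- For each `z` one of `(1, z)`, `(u, z)` is in `X`. As `⟨z⟩` and `⟨v⟩` are comparable, otherwise
  -- `(u, v)` would be joined to `(1, z)`, directly or through `(u, z)`, which has the other colour.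
  refine card_le_ncard_of_forall_exists_right fun z => ?_
  by_contra! hz
  rcases hQ.mem_zpowers_total hq (hy z) (hy v) with h | h
  · refine hca (Iff.trans (hX.color_iff _ _ (hz 1) ha ?_).symm (hone z (hz 1)))
    exact (mem_zpowers_prod_iff hco).2 ⟨one_mem _, h⟩
  · refine hca (Iff.trans (hX.color_iff _ _ ha (hz u) ?_)
      (Iff.trans (hX.color_iff _ _ (hz 1) (hz u) ?_).symm (hone z (hz 1))))
    · exact (mem_zpowers_prod_iff hco).2 ⟨mem_zpowers _, h⟩
    · exact (mem_zpowers_prod_iff hco).2 ⟨one_mem _, mem_zpowers _⟩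

end Bounds

/-! ### Lower bounds for an elementary abelian factor -/

section Elementary

variable {P Q : Type*} [CommGroup P] [CommGroup Q] [Finite P] [Finite Q]
  {X : Set (P × Q)} {c : P × Q → Prop}

/-- A mixed column contributes `q f ≥ q E`, and a disjoint `B` contributes `(q - 1) E ≥ (p - 1) E`.
-/
theorem lower_bound_of_singleton_prod_subset {p q : ℕ} {y : Q} (hp : 0 < p)
    (hpq : p < q) {E f n : ℕ} (hE : E ≤ f) (hf : orderOf y = q * f) (hn : (q - 1) * E ≤ n)
    (hy : ({1} : Set P) ×ˢ (zpowers y : Set Q) ⊆ X) {B : Set (P × Q)} (hBn : n ≤ B.ncard)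
    (hB : B ⊆ X) (hd : ∀ v, ((1 : P), v) ∈ B → v ∉ zpowers y) :
    (p + q - 1) * E ≤ X.ncard := by
  have hle := add_ncard_le hy hB (Set.disjoint_left.2 fun g hg hg' => by
    obtain ⟨u, v⟩ := g
    obtain rfl : u = 1 := hg.1
    exact hd v hg' hg.2)
  rw [Set.ncard_prod, Set.ncard_singleton, ncard_zpowers, hf] at hle
  have h2 := add_sub_one_mul_le_mul_add_sub_one_mul (e := f) (e' := E) hp hpq hE le_rfl
  omega

/-- The lower bound for a separation none of whose maximal classes is removed completely, for
an elementary abelian first factor. -/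
theorem IsSeparation.lower_bound_of_survives {p q : ℕ} (hp : p.Prime) (hq : q.Prime)
    (hQ : IsPGroup q Q) [Nontrivial P] [Nontrivial Q]
    (hQc : ¬ IsCyclic Q) (hel : ∀ x : P, x ^ p = 1) (hpq : p < q)
    (hco : (Nat.card P).Coprime (Nat.card Q)) {E : ℕ}
    (hE : ∀ y : Q, IsMaxGen y → q * E ≤ orderOf y) (hX : IsSeparation X c)
    (hs : ∀ x y, IsMaxGen x → IsMaxGen y → Survives X (x, y)) :
    Nat.card P ≤ X.ncard ∨ (p + q - 1) * E ≤ X.ncard := by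
  have hE' : ∀ {y : Q}, IsMaxGen y → ∃ f, E ≤ f ∧ orderOf y = q * f ∧
      (orderOf y).totient = (q - 1) * f ∧ orderOf (y ^ q) = f := by
    intro y hy
    obtain ⟨f, -, h1, h2, h3⟩ := hQ.exists_orderOf_eq_mul hq hy.ne_one
    exact ⟨f, Nat.le_of_mul_le_mul_left (h1 ▸ hE y hy) hq.pos, h1, h2, h3⟩
  obtain ⟨x₀, y₀, hx₀, hy₀, h₀⟩ := hX.exists_classColor hco hs
  obtain ⟨x₁, y₁, hx₁, hy₁, h₁⟩ := hX.exists_not_classColor hco hs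
  have hmixed : ∀ y y', IsMaxGen y → IsMaxGen y' →
      (∀ x, IsMaxGen x → classColor X c (x, y)) →
      (∀ x, IsMaxGen x → ¬ classColor X c (x, y')) → Nat.card P ≤ X.ncard := by
    intro y y' hy hy' h h'
    refine card_le_ncard_of_forall_exists_left fun u => ⟨1, ?_⟩
    obtain ⟨x, hx, hu⟩ := exists_isMaxGen u
    exact hX.mem_of_classColor_prod hco (hs x y hx hy) (hs x y' hx hy') (h x hx) (h' x hx) hu hu
      (one_mem _) (one_mem _)
  have hsub : ∀ {y x x'}, IsMaxGen y → IsMaxGen x → IsMaxGen x' → classColor X c (x, y) →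
      ¬ classColor X c (x', y) → ({1} : Set P) ×ˢ (zpowers y : Set Q) ⊆ X := by
    rintro y x x' hy hx hx' h h' ⟨u, v⟩ ⟨hu, hv⟩
    obtain rfl : u = 1 := hu
    exact hX.mem_of_classColor_prod hco (hs x y hx hy) (hs x' y hx' hy) h h'
      (one_mem _) (one_mem _) hv hv
  by_cases hcol : ∀ y x x', IsMaxGen y → IsMaxGen x → IsMaxGen x' →
      classColor X c (x, y) → classColor X c (x', y)
  · exact Or.inl (hmixed y₀ y₁ hy₀ hy₁ (fun x hx => hcol _ _ _ hy₀ hx₀ hx h₀)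
      fun x hx h => h₁ (hcol _ _ _ hy₁ hx hx₁ h))
  push Not at hcol
  obtain ⟨y, x, x', hy, hx, hx', h, h'⟩ := hcol
  obtain ⟨f, hEf, hfo, hft, hfp⟩ := hE' hy
  by_cases hcol' : ∀ z, IsMaxGen z → zpowers z ≠ zpowers y → ∀ x x', IsMaxGen x → IsMaxGen x' →
      classColor X c (x, z) → classColor X c (x', z)
  swap
  · push Not at hcol'
    obtain ⟨z, hz, hne, x₂, x₂', hx₂, hx₂', h₂, h₂'⟩ := hcol'
    right
    obtain ⟨g, hEg, -, hgt, -⟩ := hE' hz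
    -- With a second mixed column `z`, the generators of `⟨z⟩` are new: by maximality none of them
    -- lies in `⟨y⟩`.
    refine lower_bound_of_singleton_prod_subset (y := y) hp.pos hpq hEf hfo le_rfl
      (hsub hy hx hx' h h') (B := ({1} : Set P) ×ˢ {v | zpowers v = zpowers z}) ?_ ?_ ?_
    · rw [Set.ncard_prod, Set.ncard_singleton, ncard_generators, hgt, one_mul]
      exact Nat.mul_le_mul_left _ hEg
    · refine subset_trans ?_ (hsub hz hx₂ hx₂' h₂ h₂')
      rintro ⟨u, v⟩ ⟨hu, hv⟩
      have hv' : zpowers v = zpowers z := hv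
      exact ⟨hu, hv' ▸ mem_zpowers v⟩
    · rintro v ⟨-, hv⟩ hvy
      have hv' : zpowers v = zpowers z := hv
      exact hne (hz.zpowers_eq (zpowers_le.2 hvy (hv' ▸ mem_zpowers z)))
  -- `y` is now the only mixed column. Choosing `w` with `y ^ q ∈ ⟨w⟩` makes the cells `(t, y)` and
  -- `(t, w)` share `⟨t⟩ × ⟨y ^ q⟩`.
  obtain ⟨w, hw, hwy, hyw⟩ := hy.exists_isMaxGen_ne hq hQ hQc
  by_cases hall : ∀ z, IsMaxGen z → zpowers z ≠ zpowers y →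
      (classColor X c (x, z) ↔ classColor X c (x, w))
  swap
  · push Not at hall
    obtain ⟨z, hz, hzy, hxz⟩ := hall
    left
    rcases hxz with ⟨a, b⟩ | ⟨a, b⟩
    · exact hmixed z w hz hw (fun t ht => hcol' z hz hzy _ _ hx ht a)
        fun t ht k => b (hcol' w hw hwy _ _ ht hx k)
    · exact hmixed w z hw hz (fun t ht => hcol' w hw hwy _ _ hx ht b)
        fun t ht k => a (hcol' z hz hzy _ _ ht hx k)
  right
  have hcw : ∀ {t t'}, IsMaxGen t → IsMaxGen t' →
      classColor X c (t, w) → classColor X c (t', w) :=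
    fun ht ht' => hcol' w hw hwy _ _ ht ht'
  -- a row in which the colour at `y` differs from that at `w`
  obtain ⟨t, ht, hty⟩ : ∃ t, IsMaxGen t ∧ ∀ v ∈ zpowers (y ^ q), ∀ u ∈ zpowers t, (u, v) ∈ X := by
    have hyq : zpowers (y ^ q) ≤ zpowers y := zpowers_le.2 (npow_mem_zpowers y q)
    have hwq : zpowers (y ^ q) ≤ zpowers w := zpowers_le.2 hyw
    by_cases hxw : classColor X c (x, w)
    · exact ⟨x', hx', fun v hv u hu => hX.mem_of_classColor_prod hco (hs x' w hx' hw)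
        (hs x' y hx' hy) (hcw hx hx' hxw) h' hu hu (hwq hv) (hyq hv)⟩
    · exact ⟨x, hx, fun v hv u hu => hX.mem_of_classColor_prod hco (hs x y hx hy)
        (hs x w hx hw) h hxw hu hu (hyq hv) (hwq hv)⟩
  have hto : orderOf t = p := by
    have := Fact.mk hp
    exact orderOf_eq_prime (hel t) ht.ne_one
  -- The two pieces have `q f` and `(p - 1) f` elements, in total exactly `(p + q - 1) f`.
  have hle := add_ncard_le (hsub hy hx hx' h h')
    (B := ((zpowers t : Set P) \ {1}) ×ˢ (zpowers (y ^ q) : Set Q))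
    (fun g hg => hty _ hg.2 _ hg.1.1) (Set.disjoint_left.2 fun g hg hg' => hg'.1.2 hg.1)
  rw [Set.ncard_prod, Set.ncard_prod, Set.ncard_singleton, ncard_zpowers, ncard_zpowers,
    Set.ncard_sdiff_singleton_of_mem (zpowers t).one_mem, ncard_zpowers, hto, hfp, hfo] at hle
  have h1 : (p + q - 1) * E ≤ (p + q - 1) * f := Nat.mul_le_mul_left _ hEf
  have h2 : p + q - 1 = q + (p - 1) := by have := hp.pos; omega
  rw [h2, add_mul (a := q) (c := f)] at h1
  rw [h2]
  omega

/-- For an elementary abelian `2`-group as first factor, if all generators of `zpowers (x₁, y₁)`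
but not all generators of any other maximal cyclic subgroup are removed. -/
theorem IsSeparation.lower_bound_of_unique_not_survives {q : ℕ} (hq : q.Prime)
    (hP : IsPGroup 2 P) (hQ : IsPGroup q Q) [Nontrivial P] [Nontrivial Q] (hPc : ¬ IsCyclic P)
    (hQc : ¬ IsCyclic Q) (hel : ∀ x : P, x ^ 2 = 1) (hq2 : 2 < q)
    (hco : (Nat.card P).Coprime (Nat.card Q)) {E : ℕ}
    (hE : ∀ y : Q, IsMaxGen y → q * E ≤ orderOf y) (hX : IsSeparation X c)
    {x₁ : P} {y₁ : Q} (hx₁ : IsMaxGen x₁) (hy₁ : IsMaxGen y₁) (hs₁ : ¬ Survives X (x₁, y₁))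
    (hs : ∀ x y, IsMaxGen x → IsMaxGen y → zpowers (x, y) ≠ zpowers (x₁, y₁) →
      Survives X (x, y)) :
    Nat.card P ≤ X.ncard ∨ (2 + q - 1) * E ≤ X.ncard := by
  have hE' : ∀ {y : Q}, IsMaxGen y → ∃ f, E ≤ f ∧ orderOf y = q * f ∧
      (orderOf y).totient = (q - 1) * f := by
    intro y hy
    obtain ⟨f, -, h1, h2, h3⟩ := hQ.exists_orderOf_eq_mul hq hy.ne_one
    exact ⟨f, Nat.le_of_mul_le_mul_left (h1 ▸ hE y hy) hq.pos, h1, h2⟩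
  have hne_iff : ∀ {x y}, zpowers (x, y) ≠ zpowers (x₁, y₁) ↔
      ¬ (zpowers x = zpowers x₁ ∧ zpowers y = zpowers y₁) :=
    fun {x y} => not_congr (zpowers_prod_eq_iff hco)
  obtain ⟨x₂, hx₂, hx₂₁, -⟩ := hx₁.exists_isMaxGen_ne Nat.prime_two hP hPc
  -- a surviving vertex lies in a surviving maximal cyclic subgroup
  have hcover : ∀ a ∉ X, ∃ x y, IsMaxGen x ∧ IsMaxGen y ∧ zpowers (x, y) ≠ zpowers (x₁, y₁) ∧
      a ∈ zpowers (x, y) := by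
    rintro ⟨u, v⟩ ha
    by_cases hu1 : u = 1
    · subst hu1
      obtain ⟨y, hy, hv⟩ := exists_isMaxGen v
      exact ⟨x₂, y, hx₂, hy, hne_iff.2 fun h => hx₂₁ h.1,
        (mem_zpowers_prod_iff hco).2 ⟨one_mem _, hv⟩⟩
    obtain ⟨x, y, hx, hy, hxy⟩ := exists_isMaxGen_prod hco (u, v)
    by_cases hne : zpowers (x, y) = zpowers (x₁, y₁)
    swap
    · exact ⟨x, y, hx, hy, hne, hxy⟩
    rw [hne, mem_zpowers_prod_iff hco] at hxy
    have hu := zpowers_eq_of_mem_of_pow_prime_eq_one Nat.prime_two (hel x₁) hu1 hxy.1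
    -- Since `u` generates `⟨x₁⟩`, a surviving `(u, v)` has `v` a non-generator of `⟨y₁⟩`. So `v ∈
    -- ⟨y₁ ^ q⟩`, which lies in another maximal cyclic subgroup `⟨y'⟩`.
    have hv : zpowers v ≠ zpowers y₁ := fun hv =>
      ha (mem_of_not_survives hs₁ ((zpowers_prod_eq_iff hco).2 ⟨hu, hv⟩))
    obtain ⟨y', hy', hne', hmem⟩ := hy₁.exists_isMaxGen_ne hq hQ hQc
    refine ⟨x₁, y', hx₁, hy', hne_iff.2 fun h => hne' h.2, (mem_zpowers_prod_iff hco).2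
      ⟨hxy.1, zpowers_le.2 hmem (hQ.mem_zpowers_pow_of_zpowers_ne hq hxy.2 hv)⟩⟩
  obtain ⟨a, ha, hca⟩ := hX.exists_pos
  obtain ⟨b, hb, hcb⟩ := hX.exists_neg
  obtain ⟨x₀, y₀, hx₀, hy₀, hn₀, hm₀⟩ := hcover a ha
  obtain ⟨x₀', y₀', hx₀', hy₀', hn₀', hm₀'⟩ := hcover b hb
  have h₀ := (hX.color_iff_classColor (hs _ _ hx₀ hy₀ hn₀) ha hm₀).1 hca
  have h₀' := fun h => hcb ((hX.color_iff_classColor (hs _ _ hx₀' hy₀' hn₀') hb hm₀').2 h)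
  by_cases hcol : ∀ y x x', IsMaxGen y → IsMaxGen x → IsMaxGen x' →
      zpowers (x, y) ≠ zpowers (x₁, y₁) → zpowers (x', y) ≠ zpowers (x₁, y₁) →
      classColor X c (x, y) → classColor X c (x', y)
  · left
    refine card_le_ncard_of_forall_exists_left fun u => ?_
    obtain ⟨x, hx, hu⟩ := exists_isMaxGen u
    -- The row of `x₁` contains the removed cell, so there `(u, y₁)` replaces `(u, 1)` as the
    -- element of `X` above `u ≠ 1`.
    by_cases hxx : zpowers x = zpowers x₁
    · by_cases hu1 : u = 1
      · exact ⟨1, hu1 ▸ hX.one_mem_cutSet⟩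
      · refine ⟨y₁, mem_of_not_survives hs₁ ((zpowers_prod_eq_iff hco).2 ⟨?_, rfl⟩)⟩
        exact zpowers_eq_of_mem_of_pow_prime_eq_one Nat.prime_two (hel x₁) hu1 (hxx ▸ hu)
    · have hn : ∀ y, zpowers (x, y) ≠ zpowers (x₁, y₁) := fun y => hne_iff.2 fun h => hxx h.1
      exact ⟨1, hX.mem_of_classColor_prod hco (hs x y₀ hx hy₀ (hn _)) (hs x y₀' hx hy₀' (hn _))
        (hcol _ _ _ hy₀ hx₀ hx hn₀ (hn _) h₀)
        (fun h => h₀' (hcol _ _ _ hy₀' hx hx₀' (hn _) hn₀' h)) hu hu (one_mem _) (one_mem _)⟩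
  push Not at hcol
  obtain ⟨y, x, x', hy, hx, hx', hn, hn', h, h'⟩ := hcol
  right
  obtain ⟨f, hEf, hfo, -⟩ := hE' hy
  obtain ⟨g, hEg, -, hgt⟩ := hE' hy₁
  refine lower_bound_of_singleton_prod_subset (y := y) two_pos hq2 hEf hfo le_rfl
    (B := {g | zpowers g = zpowers (x₁, y₁)}) ?_ ?_
    (fun g hg => mem_of_not_survives hs₁ hg) ?_
  · rintro ⟨u, v⟩ ⟨hu, hv⟩
    obtain rfl : u = 1 := hu
    exact hX.mem_of_classColor_prod hco (hs x y hx hy hn) (hs x' y hx' hy hn') h h'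
      (one_mem _) (one_mem _) hv hv
  · rw [ncard_generators_prod hco, hgt]
    exact (Nat.mul_le_mul_left _ hEg).trans
      (Nat.le_mul_of_pos_left _ (Nat.totient_pos.2 (orderOf_pos _)))
  · intro v hv _
    have h1 := ((zpowers_prod_eq_iff hco).1 hv).1
    simp only [zpowers_one_eq_bot] at h1
    exact hx₁.ne_one (zpowers_eq_bot.1 h1.symm)

/-- The lower bound for an elementary abelian first factor. -/
theorem IsSeparation.lower_bound_of_elementary {p q : ℕ} (hp : p.Prime) (hq : q.Prime)
    (hP : IsPGroup p P) (hQ : IsPGroup q Q) [Nontrivial P] [Nontrivial Q] (hPc : ¬ IsCyclic P)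
    (hQc : ¬ IsCyclic Q) (hel : ∀ x : P, x ^ p = 1) (hpq : p < q)
    (hco : (Nat.card P).Coprime (Nat.card Q)) {E : ℕ}
    (hE : ∀ y : Q, IsMaxGen y → q * E ≤ orderOf y) (hX : IsSeparation X c) :
    Nat.card P ≤ X.ncard ∨ (p + q - 1) * E ≤ X.ncard := by
  by_cases hs : ∀ x y, IsMaxGen x → IsMaxGen y → Survives X (x, y)
  · exact hX.lower_bound_of_survives hp hq hQ hQc hel hpq hco hE hs
  push Not at hs
  obtain ⟨x₁, y₁, hx₁, hy₁, hs₁⟩ := hs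
  obtain ⟨e, he, -, het, -⟩ := hP.exists_orderOf_eq_mul hp hx₁.ne_one
  obtain ⟨f, hf, hfo, hft, -⟩ := hQ.exists_orderOf_eq_mul hq hy₁.ne_one
  have hEf : E ≤ f := Nat.le_of_mul_le_mul_left (hfo ▸ hE y₁ hy₁) hq.pos
  have h1 := totient_mul_totient_le_ncard hco hs₁
  simp only [het, hft] at h1
  -- For `p = 2` one removed cell may have only `(q - 1) f` elements, short of the bound when `f =
  -- E`; two removed cells suffice because `2 (q - 1) ≥ q + 1`.
  rcases hp.two_le.eq_or_lt with rfl | hp3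
  · by_cases hs : ∀ x y, IsMaxGen x → IsMaxGen y → zpowers (x, y) ≠ zpowers (x₁, y₁) →
        Survives X (x, y)
    · exact hX.lower_bound_of_unique_not_survives hq hP hQ hPc hQc hel hpq hco hE hx₁ hy₁ hs₁ hs
    push Not at hs
    obtain ⟨x₂, y₂, hx₂, hy₂, hne, hs₂⟩ := hs
    right
    obtain ⟨g, hg, hgo, hgt, -⟩ := hQ.exists_orderOf_eq_mul hq hy₂.ne_one
    have hEg : E ≤ g := Nat.le_of_mul_le_mul_left (hgo ▸ hE y₂ hy₂) hq.pos
    have hle := add_ncard_le (A := {g | zpowers g = zpowers (x₁, y₁)})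
      (B := {g | zpowers g = zpowers (x₂, y₂)})
      (fun g hg => mem_of_not_survives hs₁ hg) (fun g hg => mem_of_not_survives hs₂ hg)
      (Set.disjoint_left.2 fun g hg hg' => hne (hg'.symm.trans hg))
    rw [ncard_generators_prod hco, ncard_generators_prod hco] at hle
    simp only [hft, hgt] at hle
    have h3 := two_add_sub_one_mul_le hpq hEf hEg
    have h4 := Nat.le_mul_of_pos_left ((q - 1) * f) (Nat.totient_pos.2 (orderOf_pos x₁))
    have h5 := Nat.le_mul_of_pos_left ((q - 1) * g) (Nat.totient_pos.2 (orderOf_pos x₂))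
    omega
  · right
    have h2 := add_sub_one_mul_le_sub_one_mul_sub_one hp3 hpq hEf
    have h3 : (p - 1) * ((q - 1) * f) ≤ (p - 1) * e * ((q - 1) * f) :=
      Nat.mul_le_mul_right _ (Nat.le_mul_of_pos_right _ he)
    omega

end Elementary

/-! ### Vertex connectivity from minimum cut-sets -/

section Connectivity

theorem vertexConnectivity_eq_encard {V : Type*} [Finite V] {Γ : SimpleGraph V} {X : Set V}
    (hX : IsMinimumCutSet Γ X) : vertexConnectivity Γ = X.encard := by
  refine le_antisymm (iInf₂_le X (Or.inl hX.1)) (le_iInf₂ fun Y hY => ?_)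
  rcases hY with hY | hY
  · exact hX.2 Y hY
  -- Leaving a single vertex is never cheaper: a cut-set also leaves at least one.
  · have hne : Xᶜ.Nonempty := by
      rw [Set.nonempty_iff_ne_empty]
      intro h
      refine hX.1 fun a => ?_
      exact absurd a.2 (by simp [h])
    have h1 := Set.one_le_encard_iff_nonempty.2 hne
    have h2 : X.encard + 1 ≤ Y.encard + 1 :=
      calc X.encard + 1 ≤ X.encard + Xᶜ.encard := by gcongr
        _ = Y.encard + Yᶜ.encard := by rw [Set.encard_add_encard_compl, Set.encard_add_encard_compl]
        _ = Y.encard + 1 := by rw [hY]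
    exact (ENat.add_le_add_iff_right ENat.one_ne_top).1 h2

theorem vertexConnectivity_eq_min {V : Type*} [Finite V] {Γ : SimpleGraph V} {A B C : Set V}
    (hA : IsCutSet Γ A) (hB : IsCutSet Γ B) (hC : IsCutSet Γ C)
    (h : ∀ Y, IsCutSet Γ Y → A.encard ≤ Y.encard ∨ B.encard ≤ Y.encard ∨ C.encard ≤ Y.encard) :
    vertexConnectivity Γ = min A.encard (min B.encard C.encard) := by
  have hmin : ∀ Y, IsCutSet Γ Y → min A.encard (min B.encard C.encard) ≤ Y.encard := by
    intro Y hY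
    simpa only [min_le_iff] using h Y hY
  obtain ⟨X, hX, hXe⟩ : ∃ X, IsCutSet Γ X ∧ X.encard = min A.encard (min B.encard C.encard) := by
    rcases min_choice A.encard (min B.encard C.encard) with h1 | h1
    · exact ⟨A, hA, h1.symm⟩
    · rcases min_choice B.encard C.encard with h2 | h2
      · exact ⟨B, hB, (h1.trans h2).symm⟩
      · exact ⟨C, hC, (h1.trans h2).symm⟩
  rw [← hXe]
  exact vertexConnectivity_eq_encard ⟨hX, fun Y hY => hXe ▸ hmin Y hY⟩

end Connectivity

/-! ### Non-generators of a maximal cyclic subgroup -/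

section NonGenerators

variable {G : Type*} [Group G]

/-- By maximality, all neighbours of a generator of `C` lie in `C`, so the remaining generators are
cut off; other vertices exist because `G` is not cyclic. -/
theorem isCutSet_nonGenerators (hG : ¬ IsCyclic G) {C : Subgroup G} (hC : IsMaximalCyclic C) :
    IsCutSet (powerGraph G) (nonGenerators C) := by
  obtain ⟨m, hm, rfl⟩ := isMaximalCyclic_iff.1 hC
  refine IsSeparation.isCutSet (c := fun g => zpowers g = zpowers m)
    ⟨⟨m, fun h => h.2 rfl, rfl⟩, ?_, ?_⟩
  · by_contra! hall
    refine hG ⟨m, fun b => ?_⟩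
    change b ∈ zpowers m
    by_cases hb : b ∈ nonGenerators (zpowers m)
    · exact hb.1
    · exact hall b hb ▸ mem_zpowers b
  · intro g h hg _ hgh
    constructor
    · intro hgm
      exact ((hm.of_zpowers_eq hgm.symm).zpowers_eq hgh).symm.trans hgm
    · intro hhm
      by_contra hgm
      exact hg ⟨hhm ▸ hgh, hgm⟩

theorem ncard_nonGenerators [Finite G] (m : G) :
    (nonGenerators (zpowers m)).ncard = orderOf m - (orderOf m).totient := by
  have h : nonGenerators (zpowers m) = (zpowers m : Set G) \ {g | zpowers g = zpowers m} := rfl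
  rw [h, Set.ncard_sdiff, ncard_zpowers, ncard_generators]
  intro g hg
  have hg' : zpowers g = zpowers m := hg
  exact hg' ▸ mem_zpowers g

end NonGenerators

/-! ### Sylow decomposition and transfer of the bounds -/

section Sylow

variable {G : Type*} [CommGroup G] [Finite G] {A B : Subgroup G} {p q : ℕ}

theorem exists_mulEquiv_prod (hco : (Nat.card A).Coprime (Nat.card B))
    (hcard : Nat.card A * Nat.card B = Nat.card G) :
    ∃ f : A × B ≃* G, ∀ m, f m = m.1 * m.2 := by
  have hinj : Function.Injective (A.subtype.coprod B.subtype) := by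
    rw [injective_iff_map_eq_one]
    rintro ⟨a, b⟩ hab
    have h1 : (a : G) * b = 1 := by simpa using hab
    have h2 : (a : G) ∈ A ⊓ B := ⟨a.2, by rw [eq_inv_of_mul_eq_one_left h1]; exact B.inv_mem b.2⟩
    rw [(disjoint_of_coprime_natCard hco).eq_bot, mem_bot] at h2
    rw [h2, one_mul] at h1
    exact Prod.ext (Subtype.ext h2) (Subtype.ext h1)
  have hbij : Function.Bijective (A.subtype.coprod B.subtype) := by
    have := Fintype.ofFinite G
    have := Fintype.ofFinite (A × B)
    rw [Fintype.bijective_iff_injective_and_card]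
    refine ⟨hinj, ?_⟩
    rw [← Nat.card_eq_fintype_card, ← Nat.card_eq_fintype_card, Nat.card_prod, hcard]
  exact ⟨MulEquiv.ofBijective _ hbij, fun m => rfl⟩

/-- A nontrivial cyclic p-group has a unique subgroup of order `p`. Off `1 × Q`, the colour tells
whether that subgroup of `⟨m.1⟩` is `⟨z⟩`; it is constant along edges, and non-cyclicity of `P`
supplies a second such subgroup. -/
theorem isSeparation_singleton_one_prod {P Q : Type*} [CommGroup P] [CommGroup Q] [Finite P]
    [Finite Q] (hp : p.Prime) (hP : IsPGroup p P) (hPc : ¬ IsCyclic P)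
    (hco : (Nat.card P).Coprime (Nat.card Q)) :
    ∃ c, IsSeparation {m : P × Q | m.1 = 1} c := by
  obtain ⟨z, hz, hz1⟩ : ∃ z : P, z ^ p = 1 ∧ z ≠ 1 := by
    obtain ⟨y, hy, -⟩ := exists_isMaxGen (1 : P)
    obtain ⟨z, hz, hzy⟩ := hy.exists_pow_eq_one_notMem hp hP hPc
    exact ⟨z, hz, fun h => hzy (h ▸ one_mem _)⟩
  obtain ⟨y, hy, hzy⟩ := exists_isMaxGen z
  obtain ⟨z', hz', hzy'⟩ := hy.exists_pow_eq_one_notMem hp hP hPc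
  refine ⟨fun m => z ∈ zpowers m.1, ⟨(z, 1), hz1, mem_zpowers z⟩, ⟨(z', 1), ?_, ?_⟩, ?_⟩
  · rintro (rfl : z' = 1)
    exact hzy' (one_mem _)
  · intro h
    have := zpowers_eq_of_mem_of_pow_prime_eq_one hp hz' hz1 h
    exact hzy' (zpowers_le.2 hzy (this ▸ mem_zpowers z'))
  · intro g h hg _ hgh
    have hgh' := ((mem_zpowers_prod_iff hco).1 hgh).1
    refine ⟨fun hc => zpowers_le.2 hgh' hc, fun hc => ?_⟩
    rcases hP.mem_zpowers_total hp hc hgh' with h1 | h1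
    · exact h1
    · rw [zpowers_eq_of_mem_of_pow_prime_eq_one hp hz hg h1]
      exact mem_zpowers z

theorem isCutSet_of_not_isCyclic (hp : p.Prime) (hA : IsPGroup p A) (hAc : ¬ IsCyclic A)
    (hco : (Nat.card A).Coprime (Nat.card B)) (hcard : Nat.card A * Nat.card B = Nat.card G) :
    IsCutSet (powerGraph G) (B : Set G) := by
  obtain ⟨f, hf⟩ := exists_mulEquiv_prod hco hcard
  obtain ⟨c, hc⟩ := isSeparation_singleton_one_prod (P := A) (Q := B) hp hA hAc hco
  have hB : f.symm ⁻¹' {m : A × B | m.1 = 1} = (B : Set G) := by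
    ext g
    obtain ⟨⟨a, b⟩, rfl⟩ := f.surjective g
    rw [Set.mem_preimage, f.symm_apply_apply, Set.mem_ofPred_eq, hf, SetLike.mem_coe]
    rw [mul_mem_cancel_right b.2]
    constructor
    · intro ha
      obtain rfl : a = 1 := ha
      exact one_mem B
    · intro ha
      have h2 : (a : G) ∈ A ⊓ B := ⟨a.2, ha⟩
      rw [(disjoint_of_coprime_natCard hco).eq_bot, mem_bot] at h2
      exact Subtype.ext h2
  exact hB ▸ (hc.comap f.symm).isCutSet

theorem IsCutSet.exists_isSeparation_preimage {P Q : Type*} [Group P] [Group Q]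
    {Y : Set G} (hY : IsCutSet (powerGraph G) Y) (f : P × Q ≃* G) :
    ∃ c, IsSeparation (f ⁻¹' Y) c ∧ ((f ⁻¹' Y).ncard : ℕ∞) = Y.encard := by
  obtain ⟨c, hc⟩ := hY.exists_isSeparation
  refine ⟨_, hc.comap f, ?_⟩
  rw [Set.ncard_preimage_of_injective_subset_range f.injective
    (by rw [f.surjective.range_eq]; exact Set.subset_univ _), (Set.toFinite Y).cast_ncard_eq]

theorem encard_subgroup (H : Subgroup G) : (H : Set G).encard = Nat.card H := by
  rw [← (Set.toFinite (H : Set G)).cast_ncard_eq, ← Nat.card_coe_set_eq]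
  rfl

theorem isMinimumCutSet_of_isCyclic (hp : p.Prime) (hq : q.Prime) (hpq : p ≠ q)
    (hA : IsPGroup p A) (hB : IsPGroup q B) (hAc : ¬ IsCyclic A) (hBc : IsCyclic B)
    (hBn : Nontrivial B) (hco : (Nat.card A).Coprime (Nat.card B))
    (hcard : Nat.card A * Nat.card B = Nat.card G) :
    IsMinimumCutSet (powerGraph G) (B : Set G) ∧
      (3 ≤ p → ∀ X : Set G, IsMinimumCutSet (powerGraph G) X → X = (B : Set G)) := by
  obtain ⟨f, hf⟩ := exists_mulEquiv_prod hco hcard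
  have key : ∀ Y, IsCutSet (powerGraph G) Y → ((B : Set G) ⊆ Y ∨
      (B : Set G).encard < Y.encard ∨ (p = 2 ∧ (B : Set G).encard ≤ Y.encard)) := by
    intro Y hY
    obtain ⟨c, hc, hY'⟩ := hY.exists_isSeparation_preimage f
    rw [encard_subgroup, ← hY', Nat.cast_lt, Nat.cast_le]
    refine (hc.lower_bound_of_isCyclic hp hq hA hB hAc hpq hco).imp_left fun h b hb => ?_
    have h1 : f (1, ⟨b, hb⟩) ∈ Y := h ⟨b, hb⟩
    simpa [hf] using h1
  have hBcut := isCutSet_of_not_isCyclic hp hA hAc hco hcard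
  refine ⟨⟨hBcut, fun Y hY => ?_⟩, fun hp3 X hX => ?_⟩
  · rcases key Y hY with h | h | h
    · exact Set.encard_le_encard h
    · exact h.le
    · exact h.2
  · rcases key X hX.1 with h | h | h
    · exact ((Set.toFinite _).eq_of_subset_of_encard_le h (hX.2 _ hBcut)).symm
    · exact absurd (hX.2 _ hBcut) (not_le.2 h)
    · omega

/-- This is `n - φ(n)` for `n = p * (q * E)` with `E` a power of `q`. -/
theorem mul_sub_sub_one_mul_sub_one {p q : ℕ} (hp : 0 < p) (hq : 0 < q) (E : ℕ) :
    p * (q * E) - (p - 1) * ((q - 1) * E) = (p + q - 1) * E := by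
  obtain ⟨a, rfl⟩ := Nat.exists_eq_add_of_le' hp
  obtain ⟨b, rfl⟩ := Nat.exists_eq_add_of_le' hq
  rw [Nat.sub_eq_iff_eq_add (by gcongr <;> omega)]
  simp only [Nat.add_sub_cancel]
  rw [show a + 1 + (b + 1) - 1 = a + b + 1 by omega]
  ring

theorem IsMaxGen.map {G H : Type*} [Group G] [Group H] {m : G} (hm : IsMaxGen m) (f : G ≃* H) :
    IsMaxGen (f m) := by
  intro y hy
  have h1 : m ∈ zpowers (f.symm y) := by
    obtain ⟨n, hn⟩ := mem_zpowers_iff.1 hy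
    exact mem_zpowers_iff.2 ⟨n, by rw [← map_zpow, hn, f.symm_apply_apply]⟩
  obtain ⟨n, hn⟩ := mem_zpowers_iff.1 (hm _ h1)
  exact mem_zpowers_iff.2 ⟨n, by rw [← map_zpow, hn, f.apply_symm_apply]⟩

theorem encard_nonGenerators_of_card_eq_mul (hp : p.Prime) (hq : q.Prime) (hpq : p ≠ q)
    {C : Subgroup G} (hC : IsMaximalCyclic C) (hCcard : Nat.card C = p * q) :
    (nonGenerators C).encard = (p + q - 1 : ℕ) := by
  obtain ⟨m, -, rfl⟩ := isMaximalCyclic_iff.1 hC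
  rw [Nat.card_zpowers] at hCcard
  rw [← (Set.toFinite _).cast_ncard_eq, ncard_nonGenerators, hCcard,
    Nat.totient_mul ((Nat.coprime_primes hp hq).2 hpq), Nat.totient_prime hp, Nat.totient_prime hq]
  congr 1
  simpa only [mul_one] using mul_sub_sub_one_mul_sub_one hp.pos hq.pos 1

/-- In an elementary abelian `A` every maximal generator has order `p`, so minimality of `|C| = p *
|y|` is minimality of `|y| = q * E` among maximal generators of `B`. -/
theorem exists_encard_nonGenerators_of_elementary (hp : p.Prime) (hq : q.Prime)
    (hB : IsPGroup q B) [Nontrivial A] [Nontrivial B]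
    (hel : ∀ x : A, x ^ p = 1) (hco : (Nat.card A).Coprime (Nat.card B))
    (hcard : Nat.card A * Nat.card B = Nat.card G) {C : Subgroup G} (hC : IsMaximalCyclic C)
    (hmin : ∀ M : Subgroup G, IsMaximalCyclic M → Nat.card C ≤ Nat.card M) :
    ∃ E, (∀ y : B, IsMaxGen y → q * E ≤ orderOf y) ∧
      (nonGenerators C).encard = ((p + q - 1) * E : ℕ) := by
  obtain ⟨f, -⟩ := exists_mulEquiv_prod hco hcard
  obtain ⟨m, hm, rfl⟩ := isMaximalCyclic_iff.1 hC
  obtain ⟨⟨x, y⟩, rfl⟩ := f.surjective m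
  have hxy : IsMaxGen (x, y) := by simpa using hm.map f.symm
  obtain ⟨hx, hy⟩ := (isMaxGen_prod_iff hco).1 hxy
  have hxo : orderOf x = p := by
    have := Fact.mk hp
    exact orderOf_eq_prime (hel x) hx.ne_one
  obtain ⟨E, -, hEo, hEt, -⟩ := hB.exists_orderOf_eq_mul hq hy.ne_one
  have hord : ∀ m : A × B, orderOf (f m) = orderOf m.1 * orderOf m.2 := fun m => by
    rw [MulEquiv.orderOf_eq, orderOf_prod_of_coprime hco]
  refine ⟨E, fun z hz => ?_, ?_⟩
  · have hxz : IsMaxGen (x, z) := (isMaxGen_prod_iff hco).2 ⟨hx, hz⟩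
    have := hmin _ (isMaximalCyclic_iff.2 ⟨_, hxz.map f, rfl⟩)
    rw [Nat.card_zpowers, Nat.card_zpowers, hord, hord] at this
    rw [← hEo]
    exact Nat.le_of_mul_le_mul_left this (orderOf_pos x)
  · rw [← (Set.toFinite _).cast_ncard_eq, ncard_nonGenerators, hord, Nat.totient_mul
      (Nat.Coprime.of_dvd (orderOf_dvd_natCard x) (orderOf_dvd_natCard y) hco)]
    simp only
    rw [hEt, hEo, hxo, Nat.totient_prime hp, mul_sub_sub_one_mul_sub_one hp.pos hq.pos]

end Sylow

/-! ### The main theorem -/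

theorem theorem1p3 {G : Type*} [CommGroup G] [Finite G] (hG : ¬ IsCyclic G)
    (p₁ p₂ n₁ n₂ : ℕ) (hp₁ : p₁.Prime) (hp₂ : p₂.Prime) (hlt : p₁ < p₂)
    (hn₁ : 0 < n₁) (hn₂ : 0 < n₂) (hcard : Nat.card G = p₁ ^ n₁ * p₂ ^ n₂)
    (P₁ : Sylow p₁ G) (P₂ : Sylow p₂ G) :
    -- (i), the case where `P₁` is the non-cyclic Sylow subgroup
    (¬ IsCyclic P₁ → IsCyclic P₂ →
      IsMinimumCutSet (powerGraph G) (P₂ : Set G) ∧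
      vertexConnectivity (powerGraph G) = (Nat.card P₂ : ℕ∞) ∧
      Nat.card P₂ = p₂ ^ n₂ ∧
      (3 ≤ p₁ → ∀ X : Set G, IsMinimumCutSet (powerGraph G) X → X = (P₂ : Set G))) ∧
    -- (i), the case where `P₂` is the non-cyclic Sylow subgroup
    (IsCyclic P₁ → ¬ IsCyclic P₂ →
      IsMinimumCutSet (powerGraph G) (P₁ : Set G) ∧
      vertexConnectivity (powerGraph G) = (Nat.card P₁ : ℕ∞) ∧
      Nat.card P₁ = p₁ ^ n₁ ∧
      (∀ X : Set G, IsMinimumCutSet (powerGraph G) X → X = (P₁ : Set G))) ∧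
    -- (ii)
    (¬ IsCyclic P₁ → ¬ IsCyclic P₂ → 3 ≤ p₁ →
      ∀ C : Subgroup G, IsMaximalCyclic C → Nat.card C = p₁ * p₂ →
        vertexConnectivity (powerGraph G) =
          min (Nat.card P₁ : ℕ∞) (min (Nat.card P₂ : ℕ∞) (nonGenerators C).encard)) ∧
    -- (iii)
    (¬ IsCyclic P₁ → ¬ IsCyclic P₂ → (∀ x ∈ P₁, x ^ p₁ = 1) →
      ∀ C : Subgroup G, IsMaximalCyclic C →
        (∀ M : Subgroup G, IsMaximalCyclic M → Nat.card C ≤ Nat.card M) →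
        vertexConnectivity (powerGraph G) =
          min (Nat.card P₁ : ℕ∞) (min (Nat.card P₂ : ℕ∞) (nonGenerators C).encard)) := by
  have := Fact.mk hp₁
  have := Fact.mk hp₂
  have hne : p₁ ≠ p₂ := hlt.ne
  have hpp : (p₁ ^ n₁).Coprime (p₂ ^ n₂) :=
    Nat.Coprime.pow _ _ ((Nat.coprime_primes hp₁ hp₂).2 hne)
  have hc₁ : Nat.card P₁ = p₁ ^ n₁ := by
    rw [Sylow.card_eq_multiplicity, hcard, Nat.factorization_mul (pow_ne_zero _ hp₁.ne_zero)
      (pow_ne_zero _ hp₂.ne_zero), hp₁.factorization_pow, hp₂.factorization_pow]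
    simp [hne.symm]
  have hc₂ : Nat.card P₂ = p₂ ^ n₂ := by
    rw [Sylow.card_eq_multiplicity, hcard, Nat.factorization_mul (pow_ne_zero _ hp₁.ne_zero)
      (pow_ne_zero _ hp₂.ne_zero), hp₁.factorization_pow, hp₂.factorization_pow]
    simp [hne]
  have hco : (Nat.card (P₁ : Subgroup G)).Coprime (Nat.card (P₂ : Subgroup G)) := by
    rw [hc₁, hc₂]; exact hpp
  have hprod : Nat.card (P₁ : Subgroup G) * Nat.card (P₂ : Subgroup G) = Nat.card G := by
    rw [hc₁, hc₂, hcard]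
  have hprod' : Nat.card (P₂ : Subgroup G) * Nat.card (P₁ : Subgroup G) = Nat.card G := by
    rw [mul_comm, hprod]
  have hN₁ : Nontrivial (P₁ : Subgroup G) :=
    Finite.one_lt_card_iff_nontrivial.1 (by rw [hc₁]; exact Nat.one_lt_pow hn₁.ne' hp₁.one_lt)
  have hN₂ : Nontrivial (P₂ : Subgroup G) :=
    Finite.one_lt_card_iff_nontrivial.1 (by rw [hc₂]; exact Nat.one_lt_pow hn₂.ne' hp₂.one_lt)
  -- This makes uniqueness unconditional when `P₂` is the non-cyclic factor.
  have hp₂3 : 3 ≤ p₂ := by have := hp₁.two_le; omega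
  have hcut₂ : ¬ IsCyclic P₁ → IsCutSet (powerGraph G) (P₂ : Set G) := fun h =>
    isCutSet_of_not_isCyclic hp₁ P₁.isPGroup' h hco hprod
  have hcut₁ : ¬ IsCyclic P₂ → IsCutSet (powerGraph G) (P₁ : Set G) := fun h =>
    isCutSet_of_not_isCyclic hp₂ P₂.isPGroup' h hco.symm hprod'
  obtain ⟨f, -⟩ := exists_mulEquiv_prod hco hprod
  have he₁ : (P₁ : Set G).encard = Nat.card P₁ := encard_subgroup (P₁ : Subgroup G)
  have he₂ : (P₂ : Set G).encard = Nat.card P₂ := encard_subgroup (P₂ : Subgroup G)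
  refine ⟨fun h₁ h₂ => ?_, fun h₁ h₂ => ?_, fun h₁ h₂ h3 C hC hCc => ?_,
    fun h₁ h₂ hel C hC hmin => ?_⟩
  · obtain ⟨hm, hu⟩ := isMinimumCutSet_of_isCyclic hp₁ hp₂ hne P₁.isPGroup' P₂.isPGroup' h₁ h₂
      hN₂ hco hprod
    exact ⟨hm, (vertexConnectivity_eq_encard hm).trans he₂, hc₂, hu⟩
  · obtain ⟨hm, hu⟩ := isMinimumCutSet_of_isCyclic hp₂ hp₁ hne.symm P₂.isPGroup' P₁.isPGroup' h₂ h₁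
      hN₁ hco.symm hprod'
    exact ⟨hm, (vertexConnectivity_eq_encard hm).trans he₁, hc₁, hu hp₂3⟩
  · rw [← he₁, ← he₂]
    refine vertexConnectivity_eq_min (hcut₁ h₂) (hcut₂ h₁) (isCutSet_nonGenerators hG hC)
      fun Y hY => ?_
    obtain ⟨c, hc, hY'⟩ := hY.exists_isSeparation_preimage f
    rw [he₁, he₂, encard_nonGenerators_of_card_eq_mul hp₁ hp₂ hne hC hCc, ← hY', Nat.cast_le,
      Nat.cast_le, Nat.cast_le]
    exact hc.lower_bound_of_three_le hp₁ hp₂ P₁.isPGroup' P₂.isPGroup' h3 hlt hco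
  · rw [← he₁, ← he₂]
    refine vertexConnectivity_eq_min (hcut₁ h₂) (hcut₂ h₁) (isCutSet_nonGenerators hG hC)
      fun Y hY => ?_
    obtain ⟨c, hc, hY'⟩ := hY.exists_isSeparation_preimage f
    have hel' : ∀ x : (P₁ : Subgroup G), x ^ p₁ = 1 := fun x => Subtype.ext (hel x x.2)
    obtain ⟨E, hE, hCE⟩ := exists_encard_nonGenerators_of_elementary hp₁ hp₂ P₂.isPGroup' hel'
      hco hprod hC hmin
    rw [he₁, he₂, hCE, ← hY', Nat.cast_le, Nat.cast_le, Nat.cast_le]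
    exact (hc.lower_bound_of_elementary hp₁ hp₂ P₁.isPGroup' P₂.isPGroup' h₁ h₂ hel' hlt hco
      hE).imp_right Or.inr
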